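/- Let $X$ be a separated (Hausdorff) real locally convex topological vector space with topological dual $X^*$. Extended-real arithmetic uses the convention $(+\infty)+(-\infty)=(-\infty)+(+\infty)=-\infty$. For an extended-real-valued function $\varphi$ put $\operatorname{dom}\varphi=\{\varphi<+\infty\}$. An error function on $X$ is a map $e:X\times X\to[0,+\infty]$ that is symmetric and not identically $+\infty$. Given an error function $e$, a function $f:X\to\mathbb R\cup\{+\infty\}$ is called $e$-convex if $\operatorname{dom}f\times\operatorname{dom}f\subseteq\operatorname{dom}e$ and $$f(tx+(1-t)y)\le tf(x)+(1-t)f(y)+t(1-t)e(x,y)\qquad\text{for all }x,y\in X,\ t\in(0,1).$$ For $y\in X$ the $(e,y)$-conjugate of $f$ is the function on $X^*$ given by $$f^*_{e,y}(x^*)=\sup_{x\in X}\{\langle x^*,x\rangle-f(x)-e(x,y)\}\in[-\infty,+\infty],$$ and $(f+g)^*_{e+e',y}$ is defined by the same formula with $f+g$ and $e+e'$ in place of $f$ and $e$. The infimal convolution of $\varphi,\psi:X^*\to[-\infty,+\infty]$ is $$(\varphi\,\square\,\psi)(x^*)=\inf\{\varphi(x_1^*)+\psi(x_2^*):\ x_1^*,x_2^*\in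 X^*,\ x_1^*+x_2^*=x^*\}.$$ **Theorem.** Let $e,e'$ be error functions on $X$. Let $f:X\to\mathbb R\cup\{+\infty\}$ be $e$-convex with $e(x,x)=0$ for all $x\in\operatorname{dom}f$, and let $g:X\to\mathbb R\cup\{+\infty\}$ be $e'$-convex with $e'(z,z)=0$ for all $z\in\operatorname{dom}g$. Suppose that $f$ and $g$ are locally bounded above on $\operatorname{int}(\operatorname{dom}f)$ and $\operatorname{int}(\operatorname{dom}g)$, respectively, and that the restrictions $e(\cdot,x)|_{\operatorname{dom}f}$ and $e'(\cdot,z)|_{\operatorname{dom}g}$ are upper semicontinuous for all $x\in\operatorname{dom}f$ and $z\in\operatorname{dom}g$. Then: (i) for every $y\in X$ and $x^*\in X^*$, $$(f+g)^*_{e+e',y}(x^*)\le\bigl(f^*_{e,y}\,\square\,g^*_{e',y}\bigr)(x^*);$$ (ii) if moreover the restrictions $e|_{\operatorname{dom}f\times\operatorname{dom}f}$ and $e'|_{\operatorname{dom}g\times\operatorname{dom}g}$ are locally bounded, then for every $x^*\in X^*$ and every $y\in\operatorname{int}(\operatorname{dom}f)\cap\operatorname{int}(\operatorname{dom}g)$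 that is a local minimum point of $f+g-\langle x^*,\cdot\rangle$, equality holds in (i). -/

import Mathlib

open Set Filter Topology

noncomputable section

namespace ErrorConvex

/-- The effective domain of an extended real-valued function. -/
def dom {Z : Type*} (f : Z → EReal) : Set Z := {z | f z < ⊤}

/-- An error function: a nonnegative symmetric bifunction with values in `ℝ ∪ {+∞}`
that is finite at some pair of points. -/
structure IsErrorFunction {X : Type*} (e : X × X → EReal) : Prop where
  nonneg : ∀ p, 0 ≤ e p
  symm : ∀ x y, e (x, y) = e (y, x)
  dom_nonempty : (dom e).Nonempty

/-- `e`-convexity of a function with values in `ℝ ∪ {+∞}`. -/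
structure IsEConvex {X : Type*} [AddCommGroup X] [Module ℝ X]
    (e : X × X → EReal) (f : X → EReal) : Prop where
  ne_bot : ∀ x, f x ≠ ⊥
  dom_subset : dom f ×ˢ dom f ⊆ dom e
  le : ∀ x y : X, ∀ t ∈ Ioo (0 : ℝ) 1,
    f (t • x + (1 - t) • y) ≤
      (t : EReal) * f x + ((1 - t : ℝ) : EReal) * f y + ((t * (1 - t) : ℝ) : EReal) * e (x, y)

/-- The `(e, y)`-conjugate of `f`. (In `EReal`, as in convex analysis with the convention
`(+∞) + (-∞) = (-∞) + (+∞) = -∞`, one has `⊤ + ⊥ = ⊥ + ⊤ = ⊥`.) -/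
def eConjugate {X : Type*} [AddCommGroup X] [Module ℝ X] [TopologicalSpace X]
    (e : X × X → EReal) (y : X) (f : X → EReal) (xs : StrongDual ℝ X) : EReal :=
  ⨆ x : X, ((xs x : ℝ) : EReal) - f x - e (x, y)

/-- The infimal convolution of two extended real-valued functions. -/
def infConv {E : Type*} [AddCommGroup E] (φ ψ : E → EReal) (x : E) : EReal :=
  sInf {r | ∃ x₁ x₂ : E, x = x₁ + x₂ ∧ r = φ x₁ + ψ x₂}

/-- `φ` is locally bounded above on `s`. -/
def LocallyBoundedAboveOn {Z : Type*} [TopologicalSpace Z] (φ : Z → EReal) (s : Set Z) : Prop :=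
  ∀ z ∈ s, ∃ M : ℝ, ∀ᶠ w in 𝓝[s] z, φ w ≤ (M : EReal)

/-- The restriction of `φ` to `s` is locally bounded. -/
def LocallyBoundedOn {Z : Type*} [TopologicalSpace Z] (φ : Z → EReal) (s : Set Z) : Prop :=
  ∀ z ∈ s, ∃ M : ℝ, ∀ᶠ w in 𝓝[s] z, ((-M : ℝ) : EReal) ≤ φ w ∧ φ w ≤ (M : EReal)

end ErrorConvex

end

/-!
Part (i) holds termwise: at each point the difference defining the conjugate of the sum splits into
the two differences defining the conjugates of the summands.

For part (ii) it suffices to write `xs = x₁ + x₂` with `x₁` an `e`-subgradient of `f` at `y` and `x₂`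
an `e'`-subgradient of `g` at `y`: then both conjugates are attained at `y`, and the errors vanish
there. One-sided directional derivatives at the fixed point `y` need not be subadditive, because the
error `e (y + t • a, y + t • b)` need not be `o(t)`. The Clarke derivative, in which
the base point moves as well, is always subadditive, and it serves as the sublinear majorant.

* An `e`-convex function bounded above near `y`, with `e` bounded near `(y, y)`, is Lipschitz near `y`
  for a continuous seminorm (`IsEConvex.exists_lipschitzNear`), by the argument used for convex
  functions. Hence its Clarke derivative at `y` is finite, sublinear and bounded by a multiple of that
  seminorm.
* The Clarke derivative at `y` in direction `x - y` is at most `f x - f y + e (x, y)`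
  (`IsEConvex.clarkeDeriv_le`), so linear functionals below it are `e`-subgradients.
* At a local minimum of `f + g - xs`, the functional `xs` is below the sum of the two Clarke derivatives
  (`le_clarkeDeriv_add_of_isLocalMin`). The Hahn–Banach theorem on the diagonal of `X × X`
  (`exists_add_eq_of_le_sublinear_add`) splits `xs` accordingly, and the Lipschitz bounds make both
  parts continuous.
-/

namespace ErrorConvex

/-! ### Splitting a linear functional below a sum of sublinear functions -/

/-- Hahn–Banach on `X × X`: a linear functional dominated by the sum of two sublinear functions is
the sum of two linear functionals, each dominated by the corresponding sublinear function. -/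
theorem exists_add_eq_of_le_sublinear_add {X : Type*} [AddCommGroup X] [Module ℝ X]
    {p₁ p₂ : X → ℝ} (l : X →ₗ[ℝ] ℝ)
    (h₁ : ∀ c : ℝ, 0 < c → ∀ x, p₁ (c • x) = c * p₁ x)
    (h₂ : ∀ c : ℝ, 0 < c → ∀ x, p₂ (c • x) = c * p₂ x)
    (a₁ : ∀ x y, p₁ (x + y) ≤ p₁ x + p₁ y) (a₂ : ∀ x y, p₂ (x + y) ≤ p₂ x + p₂ y)
    (hl : ∀ x, l x ≤ p₁ x + p₂ x) :
    ∃ l₁ l₂ : X →ₗ[ℝ] ℝ, l = l₁ + l₂ ∧ (∀ x, l₁ x ≤ p₁ x) ∧ ∀ x, l₂ x ≤ p₂ x := by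
  have z₁ : p₁ 0 = 0 := by have := h₁ 2 two_pos 0; rw [smul_zero] at this; linarith
  have z₂ : p₂ 0 = 0 := by have := h₂ 2 two_pos 0; rw [smul_zero] at this; linarith
  -- `l` is viewed as a functional on the diagonal of `X × X`.
  obtain ⟨g, hg, hgN⟩ := exists_extension_of_le_sublinear
    (E := X × X)
    ⟨LinearMap.range (LinearMap.id.prod LinearMap.id : X →ₗ[ℝ] X × X),
      (l ∘ₗ LinearMap.fst ℝ X X) ∘ₗ Submodule.subtype _⟩
    (fun x => p₁ x.1 + p₂ x.2)
    (fun c hc x => by simp only [Prod.smul_fst, Prod.smul_snd, h₁ c hc, h₂ c hc]; ring)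
    (fun x y => by
      have := a₁ x.1 y.1
      have := a₂ x.2 y.2
      simp only [Prod.fst_add, Prod.snd_add]; linarith)
    (by rintro ⟨_, x, rfl⟩; exact hl x)
  refine ⟨g ∘ₗ LinearMap.inl ℝ X X, g ∘ₗ LinearMap.inr ℝ X X, ?_, fun x => ?_, fun x => ?_⟩
  · ext x
    have h : g (x, x) = l x := hg ⟨(x, x), x, rfl⟩
    rw [LinearMap.add_apply, LinearMap.comp_apply, LinearMap.comp_apply, ← map_add, ← h]
    simp
  · simpa [z₂] using hgN (x, 0)
  · simpa [z₁] using hgN (0, x)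

/-! ### The Clarke directional derivative -/

theorem eventually_snd_pos {Y : Type*} (l : Filter Y) :
    ∀ᶠ p : Y × ℝ in l ×ˢ 𝓝[>] 0, 0 < p.2 :=
  tendsto_snd.eventually self_mem_nhdsWithin

section Clarke

variable {X : Type*} [AddCommGroup X] [Module ℝ X] [TopologicalSpace X]

/-- The eventual upper bounds of the difference quotients `(F (z + t • d) - F z) / t`
as `z → y` and `t → 0⁺`. -/
def clarkeBounds (F : X → ℝ) (y d : X) : Set ℝ :=
  {c | ∀ᶠ p : X × ℝ in 𝓝 y ×ˢ 𝓝[>] 0, F (p.1 + p.2 • d) - F p.1 ≤ p.2 * c}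

/-- The Clarke directional derivative of `F` at `y` in direction `d`: the upper limit of
`(F (z + t • d) - F z) / t` as `z → y` and `t → 0⁺`, written as the infimum of the eventual upper
bounds. It is meaningful when this set of bounds is nonempty and bounded below, for instance for
`F` Lipschitz near `y`. -/
noncomputable def clarkeDeriv (F : X → ℝ) (y d : X) : ℝ := sInf (clarkeBounds F y d)

/-- `F` is Lipschitz near `y` with constant `L` with respect to the seminorm `q`. -/
def LipschitzNear (q : Seminorm ℝ X) (L : ℝ) (F : X → ℝ) (y : X) : Prop :=
  ∀ᶠ p : X × X in 𝓝 y ×ˢ 𝓝 y, F p.1 - F p.2 ≤ L * q (p.1 - p.2)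

theorem mul_mem_clarkeBounds {F : X → ℝ} {y d : X} {c a : ℝ} (ha : 0 < a)
    (hc : c ∈ clarkeBounds F y d) : a * c ∈ clarkeBounds F y (a • d) := by
  have hmul : Tendsto (fun t : ℝ => t * a) (𝓝[>] 0) (𝓝[>] 0) := by
    refine tendsto_nhdsWithin_iff.2 ⟨?_, ?_⟩
    · have : Tendsto (fun t : ℝ => t * a) (𝓝 0) (𝓝 (0 * a)) :=
        Continuous.tendsto (f := fun t : ℝ => t * a) (by fun_prop) 0
      rw [zero_mul] at this
      exact this.mono_left nhdsWithin_le_nhds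
    · filter_upwards [self_mem_nhdsWithin] with t ht
      exact mul_pos ht ha
  filter_upwards [(tendsto_fst.prodMk (hmul.comp tendsto_snd)).eventually hc] with p hp
  simp only [Function.comp_apply, mul_smul] at hp
  rw [← mul_assoc]
  exact hp

theorem LipschitzNear.continuousAt [IsTopologicalAddGroup X] {q : Seminorm ℝ X}
    (hq : Continuous q) {L : ℝ} {F : X → ℝ} {y : X} (h : LipschitzNear q L F y) : ContinuousAt F y := by
  have hlim : Tendsto (fun z => L * q (z - y)) (𝓝 y) (𝓝 0) := by
    have := (Continuous.tendsto (f := fun z => L * q (z - y)) (by fun_prop) y)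
    simpa using this
  have hdiag : Tendsto (fun z : X => (z, y)) (𝓝 y) (𝓝 y ×ˢ 𝓝 y) :=
    tendsto_id.prodMk tendsto_const_nhds
  have hdiag' : Tendsto (fun z : X => (y, z)) (𝓝 y) (𝓝 y ×ˢ 𝓝 y) :=
    tendsto_const_nhds.prodMk tendsto_id
  refine tendsto_iff_norm_sub_tendsto_zero.2 (squeeze_zero' ?_ ?_ hlim)
  · exact Eventually.of_forall fun _ => norm_nonneg _
  · filter_upwards [hdiag.eventually h, hdiag'.eventually h] with z h₁ h₂
    rw [Real.norm_eq_abs, abs_le']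
    simp only [map_sub_rev q y z] at h₁ h₂
    exact ⟨h₁, by linarith⟩

variable [IsTopologicalAddGroup X] [ContinuousSMul ℝ X]

theorem tendsto_fst_add_smul (y d : X) :
    Tendsto (fun p : X × ℝ => p.1 + p.2 • d) (𝓝 y ×ˢ 𝓝[>] 0) (𝓝 y) := by
  have h : Tendsto (fun p : X × ℝ => p.1 + p.2 • d) (𝓝 (y, 0)) (𝓝 (y + (0 : ℝ) • d)) :=
    Continuous.tendsto (f := fun p : X × ℝ => p.1 + p.2 • d) (by fun_prop) (y, 0)
  rw [zero_smul, add_zero, nhds_prod_eq] at h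
  exact h.mono_left (prod_mono le_rfl nhdsWithin_le_nhds)

theorem LipschitzNear.mem_clarkeBounds {q : Seminorm ℝ X} {L : ℝ} {F : X → ℝ} {y : X}
    (h : LipschitzNear q L F y) (d : X) : L * q d ∈ clarkeBounds F y d := by
  filter_upwards [((tendsto_fst_add_smul y d).prodMk tendsto_fst).eventually h,
    eventually_snd_pos (𝓝 y)] with p hp ht
  simp only [add_sub_cancel_left, map_smul_eq_mul, Real.norm_eq_abs, abs_of_pos ht] at hp
  linarith

theorem LipschitzNear.le_of_mem_clarkeBounds {q : Seminorm ℝ X} {L : ℝ} {F : X → ℝ} {y : X}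
    (h : LipschitzNear q L F y) {d : X} {c : ℝ} (hc : c ∈ clarkeBounds F y d) :
    -(L * q d) ≤ c := by
  obtain ⟨p, hp, ht, hpc⟩ := ((((tendsto_fst).prodMk
    (tendsto_fst_add_smul y d)).eventually h).and ((eventually_snd_pos (𝓝 y)).and hc)).exists
  simp only [sub_add_cancel_left, map_neg_eq_map, map_smul_eq_mul, Real.norm_eq_abs,
    abs_of_pos ht] at hp
  refine le_of_mul_le_mul_left ?_ ht
  linarith

theorem LipschitzNear.bddBelow_clarkeBounds {q : Seminorm ℝ X} {L : ℝ} {F : X → ℝ} {y : X}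
    (h : LipschitzNear q L F y) (d : X) : BddBelow (clarkeBounds F y d) :=
  ⟨_, fun _ hc => h.le_of_mem_clarkeBounds hc⟩

theorem LipschitzNear.clarkeDeriv_le {q : Seminorm ℝ X} {L : ℝ} {F : X → ℝ} {y : X}
    (h : LipschitzNear q L F y) (d : X) : clarkeDeriv F y d ≤ L * q d :=
  csInf_le (h.bddBelow_clarkeBounds d) (h.mem_clarkeBounds d)

theorem LipschitzNear.clarkeDeriv_add_le {q : Seminorm ℝ X} {L : ℝ} {F : X → ℝ} {y : X}
    (h : LipschitzNear q L F y) (d₁ d₂ : X) :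
    clarkeDeriv F y (d₁ + d₂) ≤ clarkeDeriv F y d₁ + clarkeDeriv F y d₂ := by
  have key : ∀ c₁ ∈ clarkeBounds F y d₁, ∀ c₂ ∈ clarkeBounds F y d₂,
      clarkeDeriv F y (d₁ + d₂) ≤ c₁ + c₂ := by
    intro c₁ hc₁ c₂ hc₂
    refine csInf_le (h.bddBelow_clarkeBounds _) ?_
    -- The base point of the second increment is shifted to `z + t • d₁`, which still tends to `y`.
    filter_upwards [hc₁, ((tendsto_fst_add_smul y d₁).prodMk tendsto_snd).eventually hc₂]
      with p h₁ h₂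
    rw [smul_add, ← add_assoc]
    linarith
  have h₁ : ∀ c₂ ∈ clarkeBounds F y d₂, clarkeDeriv F y (d₁ + d₂) - c₂ ≤ clarkeDeriv F y d₁ :=
    fun c₂ hc₂ => le_csInf ⟨_, h.mem_clarkeBounds d₁⟩
      fun c₁ hc₁ => by linarith [key c₁ hc₁ c₂ hc₂]
  have h₂ : clarkeDeriv F y (d₁ + d₂) - clarkeDeriv F y d₁ ≤ clarkeDeriv F y d₂ :=
    le_csInf ⟨_, h.mem_clarkeBounds d₂⟩ fun c₂ hc₂ => by linarith [h₁ c₂ hc₂]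
  linarith

theorem LipschitzNear.clarkeDeriv_smul {q : Seminorm ℝ X} {L : ℝ} {F : X → ℝ} {y : X}
    (h : LipschitzNear q L F y) {a : ℝ} (ha : 0 < a) (d : X) :
    clarkeDeriv F y (a • d) = a * clarkeDeriv F y d := by
  have key : ∀ (a : ℝ), 0 < a → ∀ d, clarkeDeriv F y (a • d) ≤ a * clarkeDeriv F y d := by
    intro a ha d
    rw [mul_comm, ← div_le_iff₀ ha]
    refine le_csInf ⟨_, h.mem_clarkeBounds d⟩ fun c hc => ?_
    rw [div_le_iff₀ ha, mul_comm c]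
    exact csInf_le (h.bddBelow_clarkeBounds _) (mul_mem_clarkeBounds ha hc)
  refine le_antisymm (key a ha d) ?_
  have := key a⁻¹ (inv_pos.2 ha) (a • d)
  rwa [inv_smul_smul₀ ha.ne', ← div_eq_inv_mul, le_div_iff₀ ha, mul_comm] at this

/-- A first-order condition: at a local minimum `y` of `F + G - l`, the functional `l` is dominated
by the sum of the Clarke derivatives of `F` and `G`. -/
theorem le_clarkeDeriv_add_of_isLocalMin {q r : Seminorm ℝ X} {L M : ℝ} {F G : X → ℝ} {y : X}
    (hF : LipschitzNear q L F y) (hG : LipschitzNear r M G y) (l : X →ₗ[ℝ] ℝ)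
    (hmin : IsLocalMin (fun x => F x + G x - l x) y) (d : X) :
    l d ≤ clarkeDeriv F y d + clarkeDeriv G y d := by
  have hbase : Tendsto (fun t : ℝ => (y, t)) (𝓝[>] 0) (𝓝 y ×ˢ 𝓝[>] 0) :=
    tendsto_const_nhds.prodMk tendsto_id
  have key : ∀ c₁ ∈ clarkeBounds F y d, ∀ c₂ ∈ clarkeBounds G y d, l d ≤ c₁ + c₂ := by
    intro c₁ hc₁ c₂ hc₂
    obtain ⟨t, h₁, h₂, h₃, ht⟩ := ((hbase.eventually hc₁).and ((hbase.eventually hc₂).and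
      ((((tendsto_fst_add_smul y d).comp hbase).eventually hmin).and
        (hbase.eventually (eventually_snd_pos (𝓝 y)))))).exists
    simp only [Function.comp_apply, map_add, map_smul, smul_eq_mul] at h₁ h₂ h₃ ht
    refine le_of_mul_le_mul_left ?_ ht
    linarith
  have h₁ : ∀ c₂ ∈ clarkeBounds G y d, l d - c₂ ≤ clarkeDeriv F y d :=
    fun c₂ hc₂ => le_csInf ⟨_, hF.mem_clarkeBounds d⟩
      fun c₁ hc₁ => by linarith [key c₁ hc₁ c₂ hc₂]
  have h₂ : l d - clarkeDeriv F y d ≤ clarkeDeriv G y d :=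
    le_csInf ⟨_, hG.mem_clarkeBounds d⟩ fun c₂ hc₂ => by linarith [h₁ c₂ hc₂]
  linarith

end Clarke

/-- A linear functional dominated by a multiple of a continuous seminorm is continuous. -/
theorem continuous_of_le_mul_seminorm {X : Type*} [AddCommGroup X] [Module ℝ X]
    [TopologicalSpace X] [IsTopologicalAddGroup X] {q : Seminorm ℝ X} (hq : Continuous q) {L : ℝ}
    {l : X →ₗ[ℝ] ℝ} (h : ∀ x, l x ≤ L * q x) : Continuous l := by
  refine continuous_of_continuousAt_zero l.toAddMonoidHom ?_
  have hlim : Tendsto (fun x => L * q x) (𝓝 0) (𝓝 0) := by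
    have := (hq.const_mul L).tendsto 0
    rwa [map_zero, mul_zero] at this
  have : Tendsto l (𝓝 0) (𝓝 0) := by
    refine squeeze_zero_norm (fun x => ?_) hlim
    rw [Real.norm_eq_abs, abs_le']
    refine ⟨h x, ?_⟩
    have := h (-x)
    rwa [map_neg, map_neg_eq_map] at this
  simpa [ContinuousAt] using this

/-! ### Real-valued form of `e`-convexity -/

section Real

variable {X : Type*} [AddCommGroup X] [Module ℝ X] {e : X × X → EReal} {f : X → EReal}

theorem IsEConvex.coe_toReal (hf : IsEConvex e f) {x : X} (hx : x ∈ dom f) :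
    ((f x).toReal : EReal) = f x :=
  EReal.coe_toReal (ne_of_lt hx) (hf.ne_bot x)

theorem IsEConvex.coe_toReal_error (he : IsErrorFunction e) (hf : IsEConvex e f) {x y : X}
    (hx : x ∈ dom f) (hy : y ∈ dom f) : ((e (x, y)).toReal : EReal) = e (x, y) :=
  EReal.coe_toReal (ne_of_lt (hf.dom_subset ⟨hx, hy⟩))
    (ne_of_gt (lt_of_lt_of_le EReal.bot_lt_zero (he.nonneg _)))

/-- The effective domain of an `e`-convex function is convex, and the defining inequality may be
read between real numbers there. -/
theorem IsEConvex.toReal_le (he : IsErrorFunction e) (hf : IsEConvex e f) {x y : X}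
    (hx : x ∈ dom f) (hy : y ∈ dom f) {t : ℝ} (ht : t ∈ Ioo (0 : ℝ) 1) :
    t • x + (1 - t) • y ∈ dom f ∧
      (f (t • x + (1 - t) • y)).toReal ≤
        t * (f x).toReal + (1 - t) * (f y).toReal + t * (1 - t) * (e (x, y)).toReal := by
  have h := hf.le x y t ht
  rw [← hf.coe_toReal hx, ← hf.coe_toReal hy, ← hf.coe_toReal_error he hx hy, ← EReal.coe_mul,
    ← EReal.coe_mul, ← EReal.coe_mul, ← EReal.coe_add, ← EReal.coe_add] at h
  have hd : t • x + (1 - t) • y ∈ dom f := lt_of_le_of_lt h (EReal.coe_lt_top _)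
  rw [← hf.coe_toReal hd] at h
  exact ⟨hd, EReal.coe_le_coe_iff.1 h⟩

end Real

/-! ### Local Lipschitz continuity -/

section Topological

variable {X : Type*} [AddCommGroup X] [Module ℝ X] [TopologicalSpace X]
  [IsTopologicalAddGroup X] [ContinuousSMul ℝ X] {e : X × X → EReal} {f : X → EReal}

/-- Neighbourhoods of a point of a locally convex space contain balls of continuous seminorms. -/
theorem exists_continuous_seminorm_ball_subset [LocallyConvexSpace ℝ X] {y : X} {U : Set X}
    (hU : U ∈ 𝓝 y) :
    ∃ q : Seminorm ℝ X, Continuous q ∧ ∃ r > 0, q.ball y r ⊆ U := by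
  have hw := with_gaugeSeminormFamily (𝕜 := ℝ) (E := X)
  obtain ⟨s, r, hr, h⟩ := (hw.mem_nhds_iff y U).1 hU
  exact ⟨_, Seminorm.continuous_finsetSup fun i _ => hw.continuous_seminorm i, r, hr, h⟩

/-- An `e`-convex function that is bounded above near an interior point `y` of its domain, with `e`
bounded near `(y, y)`, is Lipschitz near `y`. -/
theorem IsEConvex.exists_lipschitzNear [LocallyConvexSpace ℝ X]
    (he : IsErrorFunction e) (hf : IsEConvex e f) {y : X} (hy : y ∈ interior (dom f))
    (hfb : LocallyBoundedAboveOn f (interior (dom f)))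
    (heb : LocallyBoundedOn e (dom f ×ˢ dom f)) :
    ∃ (q : Seminorm ℝ X) (L : ℝ), Continuous q ∧
      LipschitzNear q L (fun x => (f x).toReal) y := by
  have hyd : y ∈ dom f := interior_subset hy
  have hD : dom f ∈ 𝓝 y := mem_interior_iff_mem_nhds.1 hy
  obtain ⟨M, hM⟩ := hfb y hy
  rw [isOpen_interior.nhdsWithin_eq hy] at hM
  obtain ⟨K, hK⟩ := heb (y, y) ⟨hyd, hyd⟩
  rw [nhdsWithin_eq_nhds.2 (prod_mem_nhds hD hD), nhds_prod_eq] at hK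
  obtain ⟨W, hW, hWK⟩ := eventually_prod_self_iff
    (r := fun z w => ((-K : ℝ) : EReal) ≤ e (z, w) ∧ e (z, w) ≤ (K : EReal)) |>.1 hK
  obtain ⟨q, hq, r, hr, hball⟩ :=
    exists_continuous_seminorm_ball_subset (inter_mem (inter_mem hD hM) hW)
  have hdom : ∀ z ∈ q.ball y r, z ∈ dom f := fun z hz => (hball hz).1.1
  have hup : ∀ z ∈ q.ball y r, (f z).toReal ≤ M := fun z hz => by
    have h : f z ≤ (M : EReal) := (hball hz).1.2
    rw [← hf.coe_toReal (hdom z hz)] at h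
    exact EReal.coe_le_coe_iff.1 h
  have herr : ∀ z ∈ q.ball y r, ∀ w ∈ q.ball y r, (e (z, w)).toReal ≤ K := fun z hz w hw => by
    have h := (hWK z (hball hz).2 w (hball hw).2).2
    rw [← hf.coe_toReal_error he (hdom z hz) (hdom w hw)] at h
    exact EReal.coe_le_coe_iff.1 h
  have hlow : ∀ z ∈ q.ball y r, 2 * (f y).toReal - M - K / 2 ≤ (f z).toReal := by
    intro z hz
    -- `y` is the midpoint of `z` and its reflection.
    have hz' : y + (y - z) ∈ q.ball y r := by
      rw [Seminorm.mem_ball, add_sub_cancel_left, map_sub_rev]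
      exact hz
    have h := (hf.toReal_le he (hdom z hz) (hdom _ hz') (t := 1 / 2) (by norm_num)).2
    have hmid : (1 / 2 : ℝ) • z + (1 - 1 / 2 : ℝ) • (y + (y - z)) = y := by module
    rw [hmid] at h
    have h₁ := hup _ hz'
    have h₂ := herr _ hz _ hz'
    linarith
  set m := 2 * (f y).toReal - M - K / 2 with hm
  have hyb : y ∈ q.ball y r := q.mem_ball_self hr
  have hMm : m ≤ M := (hlow y hyb).trans (hup y hyb)
  have hK0 : 0 ≤ K := (EReal.toReal_nonneg (he.nonneg _)).trans (herr y hyb y hyb)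
  refine ⟨q, (M - m + K) / (r / 2), hq, ?_⟩
  have hhalf : q.ball y (r / 2) ∈ 𝓝 y := by
    have : Tendsto (fun z => q (z - y)) (𝓝 y) (𝓝 (q (y - y))) :=
      (hq.comp (continuous_id.sub continuous_const)).tendsto y
    rw [sub_self, map_zero] at this
    exact this.eventually_lt_const (half_pos hr)
  refine mem_of_superset (prod_mem_prod hhalf hhalf) ?_
  rintro ⟨w, z⟩ ⟨hw, hz⟩
  rw [Seminorm.mem_ball] at hw hz
  have hwr : w ∈ q.ball y r := by rw [Seminorm.mem_ball]; simp only at hw; linarith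
  have hzr : z ∈ q.ball y r := by rw [Seminorm.mem_ball]; simp only at hz; linarith
  -- The segment from `z` to `w` is prolonged past `w` by a vector of seminorm less than `r / 2`;
  -- `δ` replaces `q (w - z)`, which may vanish.
  have key : ∀ δ, q (w - z) < δ →
      (f w).toReal - (f z).toReal ≤ (M - m + K) / (r / 2) * δ := by
    intro δ hδ
    have hδ0 : 0 < δ := (apply_nonneg q _).trans_lt hδ
    set s := r / 2 with hs
    have hs0 : 0 < s := half_pos hr
    set v := w + (s / δ) • (w - z) with hv
    have hvr : v ∈ q.ball y r := by
      rw [Seminorm.mem_ball, show v - y = (w - y) + (s / δ) • (w - z) by rw [hv]; abel]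
      refine (map_add_le_add q _ _).trans_lt ?_
      rw [map_smul_eq_mul, Real.norm_eq_abs, abs_of_pos (div_pos hs0 hδ0)]
      have : s / δ * q (w - z) ≤ s / δ * δ := by gcongr
      rw [div_mul_cancel₀ _ hδ0.ne'] at this
      simp only at hw
      linarith
    set t := δ / (δ + s) with ht
    have ht0 : 0 < t := by positivity
    have ht1 : t < 1 := by rw [ht, div_lt_one (by positivity)]; linarith
    have hcomb : t • v + (1 - t) • z = w := by
      have h : t * (s / δ) = 1 - t := by rw [ht]; field_simp; ring
      rw [hv, smul_add, smul_smul, h]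
      module
    have h := (hf.toReal_le he (hdom v hvr) (hdom z hzr) ⟨ht0, ht1⟩).2
    rw [hcomb] at h
    have h₁ := hup v hvr
    have h₂ := hlow z hzr
    have h₃ := herr v hvr z hzr
    have h₄ : (1 - t) * (e (v, z)).toReal ≤ K :=
      (mul_le_of_le_one_left (EReal.toReal_nonneg (he.nonneg _)) (by linarith)).trans h₃
    have h₅ : (f w).toReal - (f z).toReal ≤ t * (M - m + K) := by
      have : t * ((f v).toReal - (f z).toReal + (1 - t) * (e (v, z)).toReal) ≤
          t * (M - m + K) := by
        gcongr
      linarith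
    have h₆ : t ≤ δ / s := by
      rw [ht]; gcongr; linarith
    calc _ ≤ t * (M - m + K) := h₅
      _ ≤ δ / s * (M - m + K) := by
        gcongr
      _ = _ := by ring
  refine ge_of_tendsto (x := 𝓝[>] (q (w - z))) (f := fun δ => (M - m + K) / (r / 2) * δ) ?_ ?_
  · exact (Continuous.tendsto (f := fun δ : ℝ => (M - m + K) / (r / 2) * δ) (by fun_prop)
      _).mono_left nhdsWithin_le_nhds
  · filter_upwards [self_mem_nhdsWithin] with δ hδ using key δ hδ

/-! ### The Clarke derivative and the conjugate -/

/-- The Clarke derivative of an `e`-convex function is controlled by its increments over the whole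
domain. The inequality for the pair `x, z` bounds the quotient at a base point `z` near `y`, and upper
semicontinuity of `e (·, x)` allows `z` to tend to `y`. -/
theorem IsEConvex.clarkeDeriv_le (he : IsErrorFunction e) (hf : IsEConvex e f) {x y : X}
    (hy : y ∈ interior (dom f)) (hx : x ∈ dom f)
    (hu : UpperSemicontinuousOn (fun w => e (w, x)) (dom f))
    {q : Seminorm ℝ X} (hq : Continuous q) {L : ℝ}
    (hL : LipschitzNear q L (fun x => (f x).toReal) y) :
    clarkeDeriv (fun x => (f x).toReal) y (x - y) ≤
      (f x).toReal - (f y).toReal + (e (x, y)).toReal := by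
  have hyd : y ∈ dom f := interior_subset hy
  have hD : dom f ∈ 𝓝 y := mem_interior_iff_mem_nhds.1 hy
  refine le_of_forall_pos_le_add fun ε hε => csInf_le (hL.bddBelow_clarkeBounds _) ?_
  have hε3 : 0 < ε / 3 := by positivity
  have hE : ∀ᶠ z in 𝓝 y, e (z, x) < (((e (x, y)).toReal + ε / 3 : ℝ) : EReal) := by
    rw [← nhdsWithin_eq_nhds.2 hD]
    refine hu y hyd _ ?_
    change e (y, x) < _
    rw [he.symm y x, ← hf.coe_toReal_error he hx hyd, EReal.toReal_coe, EReal.coe_lt_coe_iff]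
    linarith
  have hF : ∀ᶠ z in 𝓝 y, (f y).toReal - ε / 3 < (f z).toReal :=
    (hL.continuousAt hq).eventually_const_lt (by simp only; linarith)
  have hqz : ∀ᶠ z in 𝓝 y, L * q (z - y) < ε / 3 := by
    have := (Continuous.tendsto (f := fun z => L * q (z - y)) (by fun_prop) y)
    exact this.eventually_lt_const (by simpa using hε3)
  have ht1 : ∀ᶠ p : X × ℝ in 𝓝 y ×ˢ 𝓝[>] 0, p.2 < 1 :=
    tendsto_snd.eventually (nhdsWithin_le_nhds (Iio_mem_nhds one_pos))
  -- `z + t • (x - z)` also tends to `y`, and lies within `t • (z - y)` of `z + t • (x - y)`.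
  have hcomb : Tendsto (fun p : X × ℝ => p.1 + p.2 • (x - p.1)) (𝓝 y ×ˢ 𝓝[>] 0) (𝓝 y) := by
    have h : Tendsto (fun p : X × ℝ => p.1 + p.2 • (x - p.1)) (𝓝 (y, 0))
        (𝓝 (y + (0 : ℝ) • (x - y))) :=
      Continuous.tendsto (f := fun p : X × ℝ => p.1 + p.2 • (x - p.1)) (by fun_prop) (y, 0)
    rw [zero_smul, add_zero, nhds_prod_eq] at h
    exact h.mono_left (prod_mono le_rfl nhdsWithin_le_nhds)
  filter_upwards [((tendsto_fst_add_smul y (x - y)).prodMk hcomb).eventually hL,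
    eventually_snd_pos (𝓝 y), ht1, tendsto_fst.eventually hE, tendsto_fst.eventually hF,
    tendsto_fst.eventually hqz, tendsto_fst.eventually hD] with ⟨z, t⟩ h₁ ht ht1 hE hF hqz hz
  simp only at h₁ ht ht1 hE hF hqz
  have hconv := (hf.toReal_le he hx hz ⟨ht, ht1⟩).2
  rw [show t • x + (1 - t) • z = z + t • (x - z) by module] at hconv
  rw [show z + t • (x - y) - (z + t • (x - z)) = t • (z - y) by module, map_smul_eq_mul,
    Real.norm_eq_abs, abs_of_pos ht] at h₁
  rw [← hf.coe_toReal_error he hz hx, EReal.coe_lt_coe_iff, he.symm z x] at hE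
  have hE0 : (1 - t) * (e (x, z)).toReal ≤ (e (x, z)).toReal :=
    mul_le_of_le_one_left (EReal.toReal_nonneg (he.nonneg _)) (by linarith)
  have : t * (L * q (z - y) + ((f x).toReal - (f z).toReal + (1 - t) * (e (x, z)).toReal)) ≤
      t * ((f x).toReal - (f y).toReal + (e (x, y)).toReal + ε) :=
    mul_le_mul_of_nonneg_left (by linarith) ht.le
  linarith

/-- A continuous linear functional below the Clarke derivative at `y` is an `e`-subgradient at `y`,
so the `(e, y)`-conjugate at `l` is at most `l y - f y`. -/
theorem IsEConvex.eConjugate_le (he : IsErrorFunction e) (hf : IsEConvex e f) {y : X}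
    (hy : y ∈ interior (dom f))
    (hu : ∀ x ∈ dom f, UpperSemicontinuousOn (fun w => e (w, x)) (dom f))
    {q : Seminorm ℝ X} (hq : Continuous q) {L : ℝ}
    (hL : LipschitzNear q L (fun x => (f x).toReal) y) {l : StrongDual ℝ X}
    (hl : ∀ d, l d ≤ clarkeDeriv (fun x => (f x).toReal) y d) :
    eConjugate e y f l ≤ ((l y - (f y).toReal : ℝ) : EReal) := by
  refine iSup_le fun x => ?_
  by_cases hx : x ∈ dom f
  · have h := (hl (x - y)).trans (hf.clarkeDeriv_le he hy hx (hu x hx) hq hL)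
    rw [map_sub] at h
    rw [← hf.coe_toReal hx, ← hf.coe_toReal_error he hx (interior_subset hy), ← EReal.coe_sub,
      ← EReal.coe_sub, EReal.coe_le_coe_iff]
    linarith
  · have : f x = ⊤ := not_lt_top_iff.1 hx
    simp [this, sub_eq_add_neg]

end Topological

/-! ### The conjugate of a sum -/

section Sum

variable {X : Type*} [AddCommGroup X] [Module ℝ X] [TopologicalSpace X]

theorem eConjugate_add_le_infConv {e e' : X × X → EReal} (he : IsErrorFunction e)
    (he' : IsErrorFunction e') {f g : X → EReal} (hf : ∀ x, f x ≠ ⊥) (hg : ∀ x, g x ≠ ⊥)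
    (y : X) (xs : StrongDual ℝ X) :
    eConjugate (e + e') y (f + g) xs ≤ infConv (eConjugate e y f) (eConjugate e' y g) xs := by
  refine le_sInf ?_
  rintro _ ⟨x₁, x₂, rfl, rfl⟩
  refine iSup_le fun x => le_trans ?_ (add_le_add
    (le_iSup (fun x => ((x₁ x : ℝ) : EReal) - f x - e (x, y)) x)
    (le_iSup (fun x => ((x₂ x : ℝ) : EReal) - g x - e' (x, y)) x))
  have h₁ := hf x
  have h₂ := hg x
  have h₃ : e (x, y) ≠ ⊥ := (lt_of_lt_of_le EReal.bot_lt_zero (he.nonneg _)).ne'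
  have h₄ : e' (x, y) ≠ ⊥ := (lt_of_lt_of_le EReal.bot_lt_zero (he'.nonneg _)).ne'
  simp only [Pi.add_apply, _root_.add_apply]
  generalize f x = a at *
  generalize g x = b at *
  generalize e (x, y) = c at *
  generalize e' (x, y) = d at *
  induction a <;> induction b <;> induction c <;> induction d <;>
    simp_all [sub_eq_add_neg]
  norm_cast
  linarith

/-- A local minimum of `f + g - xs` in the extended reals, at a point interior to both domains, is a
local minimum of the real-valued function. -/
theorem isLocalMin_toReal {f g : X → EReal} (hf : ∀ x, f x ≠ ⊥) (hg : ∀ x, g x ≠ ⊥) {y : X}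
    (hyf : y ∈ interior (dom f)) (hyg : y ∈ interior (dom g)) (xs : StrongDual ℝ X)
    (h : IsLocalMin (fun x => f x + g x - ((xs x : ℝ) : EReal)) y) :
    IsLocalMin (fun x => (f x).toReal + (g x).toReal - (xs : X →ₗ[ℝ] ℝ) x) y := by
  have key : ∀ x ∈ dom f, x ∈ dom g → f x + g x - ((xs x : ℝ) : EReal) =
      (((f x).toReal + (g x).toReal - xs x : ℝ) : EReal) := by
    intro x hxf hxg
    rw [EReal.coe_sub, EReal.coe_add, EReal.coe_toReal (ne_of_lt hxf) (hf x),
      EReal.coe_toReal (ne_of_lt hxg) (hg x)]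
  filter_upwards [h, mem_interior_iff_mem_nhds.1 hyf, mem_interior_iff_mem_nhds.1 hyg]
    with z hz hzf hzg
  rw [key z hzf hzg, key y (interior_subset hyf) (interior_subset hyg)] at hz
  exact EReal.coe_le_coe_iff.1 hz

end Sum

end ErrorConvex

/-! ### Conjugates of sums at local minima -/

theorem mainTheorem1 {X : Type*} [AddCommGroup X] [Module ℝ X] [TopologicalSpace X]
    [IsTopologicalAddGroup X] [ContinuousSMul ℝ X] [LocallyConvexSpace ℝ X] [T2Space X]
    (e e' : X × X → EReal) (he : ErrorConvex.IsErrorFunction e)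
    (he' : ErrorConvex.IsErrorFunction e')
    (f g : X → EReal) (hf : ErrorConvex.IsEConvex e f) (hg : ErrorConvex.IsEConvex e' g)
    (hef : ∀ x ∈ ErrorConvex.dom f, e (x, x) = 0)
    (heg : ∀ z ∈ ErrorConvex.dom g, e' (z, z) = 0)
    (hfb : ErrorConvex.LocallyBoundedAboveOn f (interior (ErrorConvex.dom f)))
    (hgb : ErrorConvex.LocallyBoundedAboveOn g (interior (ErrorConvex.dom g)))
    (hfu : ∀ x ∈ ErrorConvex.dom f,
      UpperSemicontinuousOn (fun w => e (w, x)) (ErrorConvex.dom f))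
    (hgu : ∀ z ∈ ErrorConvex.dom g,
      UpperSemicontinuousOn (fun w => e' (w, z)) (ErrorConvex.dom g)) :
    (∀ (y : X) (xs : StrongDual ℝ X),
      ErrorConvex.eConjugate (e + e') y (f + g) xs ≤
        ErrorConvex.infConv (ErrorConvex.eConjugate e y f)
          (ErrorConvex.eConjugate e' y g) xs) ∧
    (ErrorConvex.LocallyBoundedOn e (ErrorConvex.dom f ×ˢ ErrorConvex.dom f) →
      ErrorConvex.LocallyBoundedOn e' (ErrorConvex.dom g ×ˢ ErrorConvex.dom g) →
      ∀ (y : X) (xs : StrongDual ℝ X),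
        y ∈ interior (ErrorConvex.dom f) ∩ interior (ErrorConvex.dom g) →
        IsLocalMin (fun x => f x + g x - ((xs x : ℝ) : EReal)) y →
        ErrorConvex.eConjugate (e + e') y (f + g) xs =
          ErrorConvex.infConv (ErrorConvex.eConjugate e y f)
            (ErrorConvex.eConjugate e' y g) xs) := by
  refine ⟨ErrorConvex.eConjugate_add_le_infConv he he' hf.ne_bot hg.ne_bot, ?_⟩
  rintro heb heb' y xs ⟨hyf, hyg⟩ hmin
  refine le_antisymm
    (ErrorConvex.eConjugate_add_le_infConv he he' hf.ne_bot hg.ne_bot y xs) ?_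
  obtain ⟨q, L, hq, hL⟩ := hf.exists_lipschitzNear he hyf hfb heb
  obtain ⟨q', L', hq', hL'⟩ := hg.exists_lipschitzNear he' hyg hgb heb'
  obtain ⟨l₁, l₂, hsum, h₁, h₂⟩ := ErrorConvex.exists_add_eq_of_le_sublinear_add
    (xs : X →ₗ[ℝ] ℝ) (fun c hc => hL.clarkeDeriv_smul hc) (fun c hc => hL'.clarkeDeriv_smul hc)
    hL.clarkeDeriv_add_le hL'.clarkeDeriv_add_le
    (ErrorConvex.le_clarkeDeriv_add_of_isLocalMin hL hL' _
      (ErrorConvex.isLocalMin_toReal hf.ne_bot hg.ne_bot hyf hyg xs hmin))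
  let x₁ : StrongDual ℝ X := ⟨l₁, ErrorConvex.continuous_of_le_mul_seminorm hq
    fun x => (h₁ x).trans (hL.clarkeDeriv_le x)⟩
  let x₂ : StrongDual ℝ X := ⟨l₂, ErrorConvex.continuous_of_le_mul_seminorm hq'
    fun x => (h₂ x).trans (hL'.clarkeDeriv_le x)⟩
  have hadd : ∀ x, xs x = x₁ x + x₂ x := fun x => LinearMap.congr_fun hsum x
  have hyf' := interior_subset hyf
  have hyg' := interior_subset hyg
  calc ErrorConvex.infConv (ErrorConvex.eConjugate e y f) (ErrorConvex.eConjugate e' y g) xs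
      ≤ ErrorConvex.eConjugate e y f x₁ + ErrorConvex.eConjugate e' y g x₂ :=
        sInf_le ⟨x₁, x₂, ContinuousLinearMap.ext hadd, rfl⟩
    _ ≤ ((x₁ y - (f y).toReal : ℝ) : EReal) + ((x₂ y - (g y).toReal : ℝ) : EReal) :=
        add_le_add (hf.eConjugate_le he hyf hfu hq hL h₁) (hg.eConjugate_le he' hyg hgu hq' hL' h₂)
    _ = ((xs y : ℝ) : EReal) - (f + g) y - (e + e') (y, y) := by
        rw [Pi.add_apply, Pi.add_apply, hef y hyf', heg y hyg', ← hf.coe_toReal hyf',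
          ← hg.coe_toReal hyg', EReal.toReal_coe, EReal.toReal_coe, add_zero, sub_zero,
          ← EReal.coe_add, ← EReal.coe_add, ← EReal.coe_sub, hadd]
        congr 1
        ring
    _ ≤ ErrorConvex.eConjugate (e + e') y (f + g) xs :=
        le_iSup (fun x => ((xs x : ℝ) : EReal) - (f + g) x - (e + e') (x, y)) y
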